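/- Let $\mathbb{N}=\{1,2,3,\dots\}$, let $\{e_n\}_{n\in\mathbb{N}}$ be the standard basis of the complex Hilbert space $\ell^2(\mathbb{N})$, and let $-\Delta$ be the discrete Laplacian on $\ell^2(\mathbb{N})$, i.e. the bounded nonnegative self-adjoint operator $$(-\Delta u)_n=-u_{n-1}+2u_n-u_{n+1},\qquad n\in\mathbb{N},\quad u_0:=0.$$ For $\alpha>0$ let $(-\Delta)^\alpha$ be defined by the functional calculus. Let $U_k$ denote the Chebyshev polynomials of the second kind ($U_0=1$, $U_1(x)=2x$, $U_{k+1}(x)=2xU_k(x)-U_{k-1}(x)$). For a bounded measurable function $f$ let $M_f$ be the operator of multiplication by $f$ on $L^2((-1,1),\sqrt{1-x^2}\,dx)$. Then there is a (necessarily unique) unitary operator $\mathcal{U}:\ell^2(\mathbb{N})\to L^2((-1,1),\sqrt{1-x^2}\,dx)$ with $$\mathcal{U}e_n=\sqrt{\tfrac{2}{\pi}}\,U_{n-1}\qquad\text{for all } n\in\mathbb{N},$$ and for every $\alpha>0$ $$(-\Delta)^\alpha=\mathcal{U}^{-1}M_{2^\alpha(1-x)^\alpha}\,\mathcal{U}.$$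 Further, for every $\alpha>0$ and all $m,n\in\mathbb{N}$, the matrix entries $(-\Delta)^\alpha_{m,n}=\langle e_m,(-\Delta)^\alpha e_n\rangle$ are $$(-\Delta)^\alpha_{m,n}=(-1)^{m+n}\left[\binom{2\alpha}{\alpha+m-n}-\binom{2\alpha}{\alpha+m+n}\right],$$ where $\binom{a}{b}:=\dfrac{\Gamma(a+1)}{\Gamma(b+1)\,\Gamma(a-b+1)}$ and $1/\Gamma$ is understood as the entire reciprocal Gamma function, which vanishes at $0,-1,-2,\dots$. -/

import Mathlib

open MeasureTheory
open scoped ENNReal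

noncomputable section

namespace DiscreteLaplacian

/-! ### The discrete Laplacian on the half line -/

/-- The complex Hilbert space `ℓ²(ℕ)` with `ℕ = {1, 2, 3, …}`. -/
abbrev EllTwo : Type := lp (fun _ : ℕ+ => ℂ) 2

/-- The `n`-th vector of the standard basis of `ℓ²(ℕ)`. -/
def stdVec (n : ℕ+) : EllTwo := lp.single 2 n (1 : ℂ)

/-- The value at `k ≥ 0` of a sequence `u = (u₁, u₂, …)`, with the convention `u₀ = 0`. -/
def extZero (u : ℕ+ → ℂ) (k : ℕ) : ℂ := if h : 0 < k then u ⟨k, h⟩ else 0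

/-- The difference expression `(-Δu)_n = -u_{n-1} + 2 u_n - u_{n+1}` with `u₀ = 0`. -/
def negLaplacianFun (u : ℕ+ → ℂ) (n : ℕ+) : ℂ :=
  -extZero u ((n : ℕ) - 1) + 2 * u n - u (n + 1)

theorem extZero_succ_sub_one (u : ℕ+ → ℂ) (n : ℕ+) :
    extZero u (((n + 1 : ℕ+) : ℕ) - 1) = u n := by
  have h : ((n + 1 : ℕ+) : ℕ) - 1 = (n : ℕ) := by simp
  rw [h, extZero, dif_pos n.pos]
  rfl

theorem extZero_sub_one_eq_zero (u : ℕ+ → ℂ) (n : ℕ+)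
    (hn : n ∉ Set.range (fun k : ℕ+ => k + 1)) : extZero u ((n : ℕ) - 1) = 0 := by
  have h1 : n = 1 := by
    by_contra h
    obtain ⟨k, hk⟩ := PNat.exists_eq_succ_of_ne_one h
    exact hn ⟨k, hk.symm⟩
  subst h1
  simp [extZero]

theorem hasSum_norm_sq (u : EllTwo) :
    HasSum (fun n => ‖u n‖ ^ (2 : ℝ≥0∞).toReal) (‖u‖ ^ (2 : ℝ≥0∞).toReal) :=
  lp.hasSum_norm (by norm_num) u

theorem hasSum_right (u : EllTwo) :
    HasSum (fun n : ℕ+ => ‖extZero u ((n : ℕ) - 1)‖ ^ (2 : ℝ≥0∞).toReal)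
      (‖u‖ ^ (2 : ℝ≥0∞).toReal) := by
  have hinj : Function.Injective (fun k : ℕ+ => k + 1) := add_left_injective 1
  rw [← hinj.hasSum_iff]
  · have h : ((fun n : ℕ+ => ‖extZero u ((n : ℕ) - 1)‖ ^ (2 : ℝ≥0∞).toReal) ∘
        fun k : ℕ+ => k + 1) = fun n => ‖u n‖ ^ (2 : ℝ≥0∞).toReal := by
      funext n
      simp only [Function.comp_apply, extZero_succ_sub_one]
    rw [h]
    exact hasSum_norm_sq u
  · intro n hn
    simp [extZero_sub_one_eq_zero u n hn]

theorem summable_left (u : EllTwo) :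
    Summable (fun n : ℕ+ => ‖u (n + 1)‖ ^ (2 : ℝ≥0∞).toReal) :=
  (hasSum_norm_sq u).summable.comp_injective (add_left_injective 1)

/-- The right shift `(0, u₁, u₂, …)`. -/
def shiftRight (u : EllTwo) : EllTwo :=
  ⟨fun n => extZero u ((n : ℕ) - 1), memℓp_gen (hasSum_right u).summable⟩

/-- The left shift `(u₂, u₃, …)`. -/
def shiftLeft (u : EllTwo) : EllTwo :=
  ⟨fun n => u (n + 1), memℓp_gen (summable_left u)⟩

theorem norm_shiftRight (u : EllTwo) : ‖shiftRight u‖ ≤ ‖u‖ := by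
  refine lp.norm_le_of_tsum_le (by norm_num) (norm_nonneg _) ?_
  exact (hasSum_right u).tsum_eq.le

theorem norm_shiftLeft (u : EllTwo) : ‖shiftLeft u‖ ≤ ‖u‖ := by
  refine lp.norm_le_of_tsum_le (by norm_num) (norm_nonneg _) ?_
  rw [← (hasSum_norm_sq u).tsum_eq]
  exact tsum_comp_le_tsum_of_inj (hasSum_norm_sq u).summable
    (fun n => by positivity) (add_left_injective (1 : ℕ+))

theorem memℓp_negLaplacianFun (u : EllTwo) : Memℓp (negLaplacianFun u) 2 :=
  lp.memℓp (-shiftRight u + (2 : ℂ) • u - shiftLeft u)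

/-- The discrete Laplacian `-Δ` as a bounded linear operator on `ℓ²(ℕ)`. -/
def negLaplacian : EllTwo →L[ℂ] EllTwo :=
  LinearMap.mkContinuous
    { toFun := fun u => ⟨negLaplacianFun u, memℓp_negLaplacianFun u⟩
      map_add' := fun u v => by
        ext n
        change negLaplacianFun (fun k => u k + v k) n = negLaplacianFun u n + negLaplacianFun v n
        simp only [negLaplacianFun, extZero]
        split_ifs <;> ring
      map_smul' := fun c u => by
        ext n
        change negLaplacianFun (fun k => c * u k) n = c * negLaplacianFun u n
        simp only [negLaplacianFun, extZero]
        split_ifs <;> ring }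
    4 (fun u => by
      have h : (⟨negLaplacianFun u, memℓp_negLaplacianFun u⟩ : EllTwo) =
        -shiftRight u + (2 : ℂ) • u - shiftLeft u := rfl
      change ‖(⟨negLaplacianFun u, memℓp_negLaplacianFun u⟩ : EllTwo)‖ ≤ 4 * ‖u‖
      rw [h]
      have h1 := norm_sub_le (-shiftRight u + (2 : ℂ) • u) (shiftLeft u)
      have h2 := norm_add_le (-shiftRight u) ((2 : ℂ) • u)
      have h3 : ‖(2 : ℂ) • u‖ = 2 * ‖u‖ := by rw [norm_smul]; norm_num
      rw [norm_neg] at h2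
      linarith [norm_shiftRight u, norm_shiftLeft u])

theorem negLaplacian_apply (u : EllTwo) (n : ℕ+) :
    negLaplacian u n = -extZero u ((n : ℕ) - 1) + 2 * u n - u (n + 1) := rfl

/-- The real power `T ^ α` of a nonnegative bounded self-adjoint operator `T` on a complex Hilbert
space, given by the continuous functional calculus. -/
def operatorPow {H : Type*} [NormedAddCommGroup H] [InnerProductSpace ℂ H] [CompleteSpace H]
    (T : H →L[ℂ] H) (α : ℝ) : H →L[ℂ] H :=
  CFC.rpow T α

/-- The operator `(-Δ)^α` on `ℓ²(ℕ)`. -/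
def negLaplacianPow (α : ℝ) : EllTwo →L[ℂ] EllTwo := operatorPow negLaplacian α

/-! ### The weighted space `L²((-1,1), √(1-x²) dx)` and multiplication operators -/

/-- The measure `√(1-x²) dx` on the interval `(-1,1)`. -/
def chebyshevMeasure : Measure ℝ :=
  (volume.restrict (Set.Ioo (-1 : ℝ) 1)).withDensity
    (fun x => ENNReal.ofReal (Real.sqrt (1 - x ^ 2)))

/-- The complex Hilbert space `L²((-1,1), √(1-x²) dx)`. -/
abbrev ChebyshevLTwo : Type := Lp ℂ 2 chebyshevMeasure

/-- The operator `M_f` of multiplication by an essentially bounded measurable function `f`. -/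
def mulOperator (f : ℝ → ℂ) (hf : MemLp f ∞ chebyshevMeasure) :
    ChebyshevLTwo →L[ℂ] ChebyshevLTwo :=
  (ContinuousLinearMap.mul ℂ ℂ).holderL chebyshevMeasure ∞ 2 2 (hf.toLp f)

theorem mulOperator_apply (f : ℝ → ℂ) (hf : MemLp f ∞ chebyshevMeasure) (g : ChebyshevLTwo) :
    mulOperator f hf g =ᵐ[chebyshevMeasure] fun x => f x * g x := by
  have h := (ContinuousLinearMap.mul ℂ ℂ).coeFn_holder (r := 2) (hf.toLp f) g
  filter_upwards [h, hf.coeFn_toLp] with x hx hx'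
  rw [← hx']
  exact hx

/-- The function `x ↦ 2^α (1-x)^α`. -/
def powSymbol (α : ℝ) (x : ℝ) : ℂ := (((2 : ℝ) ^ α * (1 - x) ^ α : ℝ) : ℂ)

theorem memLp_powSymbol {α : ℝ} (hα : 0 < α) : MemLp (powSymbol α) ∞ chebyshevMeasure := by
  refine memLp_top_of_bound (C := (2 : ℝ) ^ α * 2 ^ α) ?_ ?_
  · refine Measurable.aestronglyMeasurable ?_
    unfold powSymbol
    fun_prop
  · refine (withDensity_absolutelyContinuous _ _).ae_le ?_
    filter_upwards [ae_restrict_mem measurableSet_Ioo] with x hx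
    have h0 : (0 : ℝ) ≤ 1 - x := by linarith [hx.2]
    have h2 : 1 - x ≤ 2 := by linarith [hx.1]
    have h3 : (0 : ℝ) ≤ (2 : ℝ) ^ α * (1 - x) ^ α := by positivity
    rw [powSymbol, Complex.norm_real, Real.norm_of_nonneg h3]
    gcongr

/-! ### The Chebyshev transform -/

/-- A unitary operator `𝒰 : ℓ²(ℕ) → L²((-1,1), √(1-x²) dx)` is the Chebyshev transform if
`𝒰 e_n = √(2/π) U_{n-1}` for all `n ≥ 1`, with `U_k` the `k`-th Chebyshev polynomial of the
second kind. Since the `e_n` span a dense subspace, there is at most one such `𝒰`. -/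
def IsChebyshevTransform (𝒰 : EllTwo ≃ₗᵢ[ℂ] ChebyshevLTwo) : Prop :=
  ∀ n : ℕ+, 𝒰 (stdVec n) =ᵐ[chebyshevMeasure] fun x : ℝ =>
    ((Real.sqrt (2 / Real.pi) *
      (Polynomial.Chebyshev.U ℝ ((n : ℤ) - 1)).eval x : ℝ) : ℂ)

/-! ### Matrix entries and binomials -/

/-- The matrix entry `A_{m,n} = ⟨e_m, A e_n⟩` (the inner product is linear in the second
argument). -/
def matrixEntry (A : EllTwo →L[ℂ] EllTwo) (m n : ℕ+) : ℂ :=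
  inner ℂ (stdVec m) (A (stdVec n))

/-- The generalized binomial number `Γ(a+1) / (Γ(b+1) Γ(a-b+1))`, with `1/Γ` the entire
reciprocal Gamma function: `Real.Gamma` is `0` at its poles `0, -1, -2, …` and `0⁻¹ = 0`,
so that `(Real.Gamma s)⁻¹` is the value of `1/Γ` at every real `s`. -/
def genBinom (a b : ℝ) : ℝ :=
  Real.Gamma (a + 1) * (Real.Gamma (b + 1))⁻¹ * (Real.Gamma (a - b + 1))⁻¹

end DiscreteLaplacian

end

noncomputable section

namespace DiscreteLaplacian

/-! ### Fourier cosine coefficients of `(2 - 2 cos θ) ^ α` -/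

/-! Under `x = cos θ`, `U_{n-1}(x) sin θ = sin nθ`, so the vectors `√(2/π) U_{n-1}` are an
orthonormal sine system; Weierstrass approximation makes it a basis. The recurrence `2x U_{n-1} =
U_{n-2} + U_n`, with `U_{-1} = 0` playing the role of `u₀ = 0`, says that multiplication by `2(1-x)`
acts on this basis as `-Δ` acts on the `e_n` (`ellTwoRep_laplacianSymbol`). Conjugated
multiplication is a continuous star homomorphism on `C([-1,1])`, hence commutes with the functional
calculus (`negLaplacianPow_eq_ellTwoRep`).

For the entries, `2 sin mθ sin nθ = cos (m-n)θ - cos (m+n)θ` leaves two cosine coefficients of `(2 -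
2 cos θ)^α`. These obey a first-order recurrence in `k` (`cosCoeff_add_one`), which the signed
binomials share (`genBinom_add_one`); the value at `k = 0` is a Beta integral (`cosCoeff_zero`). -/

/-- The integral `∫₀^π cos (kθ) (2 - 2 cos θ) ^ α dθ`. -/
def cosCoeff (α k : ℝ) : ℝ :=
  ∫ θ in (0 : ℝ)..Real.pi, Real.cos (k * θ) * (2 - 2 * Real.cos θ) ^ α

theorem continuous_two_sub_two_cos_rpow {α : ℝ} (hα : 0 < α) :
    Continuous fun θ : ℝ => (2 - 2 * Real.cos θ) ^ α :=
  (by fun_prop : Continuous fun θ : ℝ => 2 - 2 * Real.cos θ).rpow_const fun _ => Or.inr hα.le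

/-- Rests on `2 sin θ (sin (k+1)θ - sin kθ) = (2 - 2 cos θ)(cos (k+1)θ + cos kθ)`, which restores
the power lost by differentiating. The derivative thus involves only two consecutive integrands of
`cosCoeff`. -/
theorem hasDerivAt_two_sub_two_cos_rpow_mul (α k : ℝ) {θ : ℝ} (hθ : θ ∈ Set.Ioo 0 Real.pi) :
    HasDerivAt (fun θ : ℝ => (2 - 2 * Real.cos θ) ^ α *
        (Real.sin ((k + 1) * θ) - Real.sin (k * θ)))
      ((α + k + 1) * (Real.cos ((k + 1) * θ) * (2 - 2 * Real.cos θ) ^ α) +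
        (α - k) * (Real.cos (k * θ) * (2 - 2 * Real.cos θ) ^ α)) θ := by
  have hpos : 0 < 2 - 2 * Real.cos θ := by
    have h := Real.cos_lt_cos_of_nonneg_of_le_pi le_rfl hθ.2.le hθ.1
    rw [Real.cos_zero] at h
    linarith
  have h1 : HasDerivAt (fun θ : ℝ => 2 - 2 * Real.cos θ) (2 * Real.sin θ) θ := by
    simpa using ((Real.hasDerivAt_cos θ).const_mul 2).const_sub 2
  have h2 := h1.rpow_const (p := α) (Or.inl hpos.ne')
  have h3 : ∀ c : ℝ, HasDerivAt (fun θ : ℝ => Real.sin (c * θ)) (Real.cos (c * θ) * c) θ := by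
    intro c
    simpa using ((hasDerivAt_id θ).const_mul c).sin
  refine (h2.mul ((h3 (k + 1)).sub (h3 k))).congr_deriv ?_
  have hw : (2 - 2 * Real.cos θ) ^ α = (2 - 2 * Real.cos θ) ^ (α - 1) * (2 - 2 * Real.cos θ) := by
    rw [← Real.rpow_add_one hpos.ne', sub_add_cancel]
  have hadd : (k + 1) * θ = k * θ + θ := by ring
  rw [hw]
  have hsq := Real.sin_sq_add_cos_sq θ
  generalize (2 - 2 * Real.cos θ) ^ (α - 1) = w at *
  simp only [Pi.sub_apply, hadd, Real.sin_add, Real.cos_add]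
  linear_combination (2 * α * w * Real.cos (k * θ)) * hsq

/-- The primitive vanishes at `0` and, since `k` is an integer, at `π`. Differentiability is used
only inside the interval, since the power may fail to be smooth at `θ = 0`. -/
theorem cosCoeff_add_one {α : ℝ} (hα : 0 < α) (k : ℕ) :
    (α + k + 1) * cosCoeff α (k + 1) = -((α - k) * cosCoeff α k) := by
  have hc := continuous_two_sub_two_cos_rpow hα
  have hi : ∀ c : ℝ, IntervalIntegrable
      (fun θ : ℝ => Real.cos (c * θ) * (2 - 2 * Real.cos θ) ^ α) volume 0 Real.pi := fun c =>
    ((by fun_prop : Continuous fun θ : ℝ => Real.cos (c * θ)).mul hc).intervalIntegrable _ _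
  have h := intervalIntegral.integral_eq_sub_of_hasDerivAt_of_le Real.pi_pos.le
    (hc.mul (by fun_prop : Continuous fun θ : ℝ =>
      Real.sin (((k : ℝ) + 1) * θ) - Real.sin (k * θ))).continuousOn
    (fun θ hθ => hasDerivAt_two_sub_two_cos_rpow_mul α k hθ)
    (((hi _).const_mul _).add ((hi _).const_mul _))
  rw [intervalIntegral.integral_add ((hi _).const_mul _) ((hi _).const_mul _),
    intervalIntegral.integral_const_mul, intervalIntegral.integral_const_mul] at h
  have hs : Real.sin (((k : ℝ) + 1) * Real.pi) = 0 := by exact_mod_cast Real.sin_nat_mul_pi (k + 1)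
  simp only [Pi.mul_apply, hs, Real.sin_nat_mul_pi, mul_zero, Real.sin_zero, sub_self] at h
  change _ * cosCoeff α (k + 1) + _ * cosCoeff α k = 0 at h
  linarith

theorem beta_eq_integral {a b : ℝ} (ha : 0 < a) (hb : 0 < b) :
    ProbabilityTheory.beta a b = ∫ x in (0 : ℝ)..1, x ^ (a - 1) * (1 - x) ^ (b - 1) := by
  rw [ProbabilityTheory.beta_eq_betaIntegralReal a b ha hb, Complex.betaIntegral]
  have h : ∀ x ∈ Set.uIcc (0 : ℝ) 1, (x : ℂ) ^ ((a : ℂ) - 1) * (1 - (x : ℂ)) ^ ((b : ℂ) - 1) =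
      ((x ^ (a - 1) * (1 - x) ^ (b - 1) : ℝ) : ℂ) := by
    intro x hx
    rw [Set.uIcc_of_le zero_le_one] at hx
    push_cast
    rw [Complex.ofReal_cpow hx.1, Complex.ofReal_cpow (by linarith [hx.2])]
    push_cast
    rfl
  rw [intervalIntegral.integral_congr h, intervalIntegral.integral_ofReal, Complex.ofReal_re]

theorem cosCoeff_zero_eq_beta {α : ℝ} (hα : 0 < α) :
    cosCoeff α 0 = 4 ^ α * ProbabilityTheory.beta (α + 1 / 2) (1 / 2) := by
  have h1 : cosCoeff α 0 = ∫ x in (-1 : ℝ)..1, (2 - 2 * x) ^ α * √(1 - x ^ 2)⁻¹ := by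
    rw [← Polynomial.Chebyshev.integral_measureT fun x => (2 - 2 * x) ^ α,
      Polynomial.Chebyshev.integral_measureT_eq_integral_cos]
    simp [cosCoeff]
  -- The substitution `x = 1 - 2t` gives `2 - 2x = 4t` and `1 - x² = 4t(1 - t)`, a Beta integrand.
  have h2 := intervalIntegral.smul_integral_comp_sub_mul (a := 0) (b := 1)
    (fun x : ℝ => (2 - 2 * x) ^ α * √(1 - x ^ 2)⁻¹) 2 1
  norm_num [-Real.sqrt_inv] at h2
  rw [h1, ← h2, beta_eq_integral (by linarith) (by norm_num),
    ← intervalIntegral.integral_const_mul, ← intervalIntegral.integral_const_mul]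
  refine intervalIntegral.integral_congr_ae ?_
  have hne : ∀ᵐ x : ℝ, x ≠ 1 := by
    simp [ae_iff]
  filter_upwards [hne] with t ht1 ht
  rw [Set.uIoc_of_le zero_le_one] at ht
  have h0 : 0 < t := ht.1
  have hlt : 0 < 1 - t := sub_pos.2 (lt_of_le_of_ne ht.2 ht1)
  have e1 : (2 - 2 * (1 - 2 * t)) = 4 * t := by ring
  have e2 : 1 - (1 - 2 * t) ^ 2 = 2 ^ 2 * (t * (1 - t)) := by ring
  have e3 : α + 1 / 2 - 1 = α + -(1 / 2) := by ring
  have e4 : (1 / 2 - 1 : ℝ) = -(1 / 2) := by norm_num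
  rw [e1, e2, e3, e4, Real.rpow_add h0, Real.mul_rpow (by norm_num) h0.le, Real.sqrt_inv,
    Real.sqrt_mul (by norm_num), Real.sqrt_sq (by norm_num), Real.sqrt_mul h0.le,
    Real.rpow_neg h0.le, Real.rpow_neg hlt.le, ← Real.sqrt_eq_rpow, ← Real.sqrt_eq_rpow]
  field_simp

theorem genBinom_symm (a b : ℝ) : genBinom a (a - b) = genBinom a b := by
  rw [genBinom, genBinom, sub_sub_cancel]
  ring

theorem cosCoeff_zero {α : ℝ} (hα : 0 < α) :
    cosCoeff α 0 = Real.pi * genBinom (2 * α) α := by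
  -- Duplication at `α + 1/2` trades `Γ(α + 1/2)` for `Γ(2α + 1) / Γ(α + 1)`.
  have h1 := Real.Gamma_mul_Gamma_add_half (α + 1 / 2)
  have hG := (Real.Gamma_pos_of_pos (by linarith : 0 < α + 1)).ne'
  have e1 : α + 1 / 2 + 1 / 2 = α + 1 := by ring
  have e2 : 2 * (α + 1 / 2) = 2 * α + 1 := by ring
  have e3 : 1 - (2 * α + 1) = -(2 * α) := by ring
  have e4 : 2 * α - α + 1 = α + 1 := by ring
  have h4 : (4 : ℝ) ^ α = 2 ^ (2 * α) := by
    rw [Real.rpow_mul (by norm_num)]; norm_num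
  have h2 : (2 : ℝ) ^ (2 * α) ≠ 0 := (Real.rpow_pos_of_pos (by norm_num) _).ne'
  rw [e1, e2, e3, Real.rpow_neg (by norm_num)] at h1
  rw [cosCoeff_zero_eq_beta hα, ProbabilityTheory.beta, genBinom, e1, e4, Real.Gamma_one_half_eq,
    h4]
  have h5 : Real.pi = √Real.pi * √Real.pi := (Real.mul_self_sqrt Real.pi_pos.le).symm
  have h6 : Real.Gamma (α + 1 / 2) =
      Real.Gamma (2 * α + 1) * (2 ^ (2 * α))⁻¹ * √Real.pi * (Real.Gamma (α + 1))⁻¹ := by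
    rw [← h1]; field_simp
  rw [h6]
  nth_rewrite 3 [h5]
  field_simp

/-- With `1/Γ = 0` at the poles, the functional equation has no exceptional points, so integer `α`
needs no separate treatment. -/
theorem inv_Gamma_eq_mul_inv_Gamma_add_one (s : ℝ) :
    (Real.Gamma s)⁻¹ = s * (Real.Gamma (s + 1))⁻¹ := by
  rcases eq_or_ne s 0 with rfl | hs
  · simp
  · rw [Real.Gamma_add_one hs]
    field_simp

theorem genBinom_add_one (α : ℝ) (k : ℕ) :
    (α + k + 1) * genBinom (2 * α) (α + k + 1) = (α - k) * genBinom (2 * α) (α + k) := by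
  have h1 := inv_Gamma_eq_mul_inv_Gamma_add_one (α + k + 1)
  have h2 := inv_Gamma_eq_mul_inv_Gamma_add_one (α - k)
  have e1 : 2 * α - (α + k + 1) + 1 = α - k := by ring
  have e2 : 2 * α - (α + k) + 1 = α - k + 1 := by ring
  rw [genBinom, genBinom, e1, e2, h1, h2]
  ring

theorem cosCoeff_natCast {α : ℝ} (hα : 0 < α) (k : ℕ) :
    cosCoeff α k = Real.pi * ((-1) ^ k * genBinom (2 * α) (α + k)) := by
  induction k with
  | zero => simpa using cosCoeff_zero hα
  | succ k ih =>
    -- Only this factor is cancelled; `α - k` may vanish.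
    have hne : α + k + 1 ≠ 0 := by positivity
    apply mul_left_cancel₀ hne
    push_cast
    have h := genBinom_add_one α k
    rw [cosCoeff_add_one hα k, ih, ← add_assoc, pow_succ]
    linear_combination (Real.pi * (-1) ^ k) * h

theorem cosCoeff_neg (α k : ℝ) : cosCoeff α (-k) = cosCoeff α k := by
  simp [cosCoeff]

/-- Evenness of cosine matches the symmetry `b ↔ a - b` of the binomial, and `m + n` has the parity
of `|m - n|`. -/
theorem cosCoeff_sub {α : ℝ} (hα : 0 < α) (m n : ℕ) :
    cosCoeff α ((m : ℝ) - n) =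
      Real.pi * ((-1) ^ (m + n) * genBinom (2 * α) (α + m - n)) := by
  rcases le_total n m with h | h <;> obtain ⟨k, rfl⟩ := Nat.exists_eq_add_of_le h
  · have e1 : ((n + k : ℕ) : ℝ) - n = k := by push_cast; ring
    have e2 : α + ((n + k : ℕ) : ℝ) - n = α + k := by push_cast; ring
    have e3 : n + k + n = k + 2 * n := by ring
    rw [e1, e2, cosCoeff_natCast hα, e3, pow_add, pow_mul]
    simp
  · have e1 : (m : ℝ) - (m + k : ℕ) = -k := by push_cast; ring
    have e2 : α + m - ((m + k : ℕ) : ℝ) = 2 * α - (α + k) := by push_cast; ring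
    have e3 : m + (m + k) = k + 2 * m := by ring
    rw [e1, e2, cosCoeff_neg, genBinom_symm, cosCoeff_natCast hα, e3, pow_add, pow_mul]
    simp

/-! ### Integrals against the weight `√(1 - x ^ 2)` -/

theorem integral_chebyshevMeasure_eq_integral_cos (g : ℝ → ℝ) :
    ∫ x, g x ∂chebyshevMeasure =
      ∫ θ in (0 : ℝ)..Real.pi, g (Real.cos θ) * Real.sin θ ^ 2 := by
  have h1 : ∫ x, g x ∂chebyshevMeasure =
      ∫ x in Set.Ioo (-1 : ℝ) 1, √(1 - x ^ 2) * g x := by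
    rw [chebyshevMeasure, integral_withDensity_eq_integral_toReal_smul (by fun_prop) (by simp)]
    refine integral_congr_ae (Filter.Eventually.of_forall fun x => ?_)
    simp [ENNReal.toReal_ofReal (Real.sqrt_nonneg _)]
  have h2 : ∫ x in Set.Ioo (-1 : ℝ) 1, √(1 - x ^ 2) * g x =
      ∫ x, g x * (1 - x ^ 2) ∂Polynomial.Chebyshev.measureT := by
    rw [Polynomial.Chebyshev.integral_measureT, intervalIntegral.integral_of_le (by norm_num),
      integral_Ioc_eq_integral_Ioo]
    refine setIntegral_congr_fun measurableSet_Ioo fun x hx => ?_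
    have hx2 : 0 < 1 - x ^ 2 := by nlinarith [hx.1, hx.2]
    have hs := Real.sqrt_pos.2 hx2
    simp only [Real.sqrt_inv]
    have : (1 - x ^ 2) = √(1 - x ^ 2) * √(1 - x ^ 2) := (Real.mul_self_sqrt hx2.le).symm
    nth_rewrite 2 [this]
    field_simp
  rw [h1, h2, Polynomial.Chebyshev.integral_measureT_eq_integral_cos]
  refine intervalIntegral.integral_congr fun θ _ => ?_
  simp only [Real.sin_sq]

/-- The product formula for the polynomials `U_k` in terms of cosine integrals. -/
theorem integral_U_mul_U_mul {g : ℝ → ℝ} (hg : Continuous fun θ => g (Real.cos θ)) (m n : ℤ) :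
    ∫ x, (Polynomial.Chebyshev.U ℝ (m - 1)).eval x * (Polynomial.Chebyshev.U ℝ (n - 1)).eval x *
        g x ∂chebyshevMeasure =
      ((∫ θ in (0 : ℝ)..Real.pi, Real.cos (((m : ℝ) - n) * θ) * g (Real.cos θ)) -
        ∫ θ in (0 : ℝ)..Real.pi, Real.cos (((m : ℝ) + n) * θ) * g (Real.cos θ)) / 2 := by
  have hi : ∀ c : ℝ, IntervalIntegrable
      (fun θ : ℝ => Real.cos (c * θ) * g (Real.cos θ)) volume 0 Real.pi := fun c =>
    ((by fun_prop : Continuous fun θ : ℝ => Real.cos (c * θ)).mul hg).intervalIntegrable _ _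
  rw [integral_chebyshevMeasure_eq_integral_cos, ← intervalIntegral.integral_sub (hi _) (hi _),
    ← intervalIntegral.integral_div]
  refine intervalIntegral.integral_congr fun θ _ => ?_
  -- Each polynomial absorbs one factor of `sin² θ`.
  have h1 := Polynomial.Chebyshev.U_real_cos θ (m - 1)
  have h2 := Polynomial.Chebyshev.U_real_cos θ (n - 1)
  push_cast at h1 h2
  rw [sub_add_cancel] at h1 h2
  rw [sub_mul, add_mul, Real.cos_sub, Real.cos_add]
  linear_combination (g (Real.cos θ) * (Polynomial.Chebyshev.U ℝ (n - 1)).eval (Real.cos θ) *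
    Real.sin θ) * h1 + (g (Real.cos θ) * Real.sin (m * θ)) * h2

theorem integral_cos_int_mul (k : ℤ) :
    ∫ θ in (0 : ℝ)..Real.pi, Real.cos (k * θ) = if k = 0 then Real.pi else 0 := by
  have h := Polynomial.Chebyshev.integral_measureT_eq_integral_cos
    (f := fun x => (Polynomial.Chebyshev.T ℝ k).eval x)
  simp only [Polynomial.Chebyshev.T_real_cos] at h
  rw [← h]
  split_ifs with hk
  · rw [hk, Polynomial.Chebyshev.integral_eval_T_real_measureT_zero]
  · exact Polynomial.Chebyshev.integral_eval_T_real_measureT_of_ne_zero hk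

theorem integral_U_mul_U {m n : ℤ} (hm : 0 < m) (hn : 0 < n) :
    ∫ x, (Polynomial.Chebyshev.U ℝ (m - 1)).eval x * (Polynomial.Chebyshev.U ℝ (n - 1)).eval x
        ∂chebyshevMeasure = if m = n then Real.pi / 2 else 0 := by
  have h := integral_U_mul_U_mul (g := fun _ => 1) continuous_const m n
  have h1 := integral_cos_int_mul (m - n)
  have h2 := integral_cos_int_mul (m + n)
  push_cast at h1 h2
  simp only [mul_one] at h
  rw [h, h1, h2, if_neg (by omega : ¬ m + n = 0), sub_zero]
  simp only [sub_eq_zero]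
  split_ifs <;> simp


open Polynomial (X)
open scoped Polynomial ComplexConjugate

/-! ### Continuous functions on `[-1, 1]` acting on the weighted space -/

instance isFiniteMeasure_chebyshevMeasure : IsFiniteMeasure chebyshevMeasure := by
  refine isFiniteMeasure_withDensity (ne_of_lt ?_)
  refine lt_of_le_of_lt (lintegral_mono (g := fun _ => 1) fun x => ?_) (by simp)
  rw [ENNReal.ofReal_le_one, Real.sqrt_le_one]
  nlinarith [sq_nonneg x]

theorem ae_mem_Ioo_chebyshevMeasure : ∀ᵐ x ∂chebyshevMeasure, x ∈ Set.Ioo (-1 : ℝ) 1 :=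
  (withDensity_absolutelyContinuous _ _).ae_le (ae_restrict_mem measurableSet_Ioo)

/-- The constant extension to `ℝ` of a continuous function on `[-1, 1]`. -/
def extendIcc (g : C(Set.Icc (-1 : ℝ) 1, ℂ)) : ℝ → ℂ :=
  Set.IccExtend (by norm_num) g

theorem extendIcc_of_mem (g : C(Set.Icc (-1 : ℝ) 1, ℂ)) {x : ℝ} (hx : x ∈ Set.Icc (-1 : ℝ) 1) :
    extendIcc g x = g ⟨x, hx⟩ :=
  Set.IccExtend_of_mem _ _ hx

theorem ae_extendIcc_eq {g : C(Set.Icc (-1 : ℝ) 1, ℂ)} {f : ℝ → ℂ}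
    (h : ∀ x : Set.Icc (-1 : ℝ) 1, g x = f x) : extendIcc g =ᵐ[chebyshevMeasure] f := by
  filter_upwards [ae_mem_Ioo_chebyshevMeasure] with x hx
  rw [extendIcc_of_mem g (Set.Ioo_subset_Icc_self hx), h]

theorem norm_extendIcc_le (g : C(Set.Icc (-1 : ℝ) 1, ℂ)) (x : ℝ) : ‖extendIcc g x‖ ≤ ‖g‖ :=
  g.norm_coe_le_norm _

theorem memLp_extendIcc (g : C(Set.Icc (-1 : ℝ) 1, ℂ)) (p : ℝ≥0∞) :
    MemLp (extendIcc g) p chebyshevMeasure :=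
  MemLp.of_bound (g.continuous.Icc_extend' (h := by norm_num)).aestronglyMeasurable ‖g‖
    (Filter.Eventually.of_forall (norm_extendIcc_le g))

/-- The class in `L²` of a continuous function on `[-1, 1]`. -/
def contClass : C(Set.Icc (-1 : ℝ) 1, ℂ) →ₗ[ℂ] ChebyshevLTwo where
  toFun g := (memLp_extendIcc g 2).toLp
  map_add' _ _ := rfl
  map_smul' _ _ := rfl

theorem coeFn_contClass (g : C(Set.Icc (-1 : ℝ) 1, ℂ)) :
    contClass g =ᵐ[chebyshevMeasure] extendIcc g :=
  (memLp_extendIcc g 2).coeFn_toLp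

theorem continuous_contClass : Continuous contClass := by
  refine AddMonoidHomClass.continuous_of_bound contClass
    (((measureUnivNNReal chebyshevMeasure : ℝ) ^ ((2 : ℝ≥0∞).toReal)⁻¹)) fun g => ?_
  refine Lp.norm_le_of_ae_bound (norm_nonneg _) ?_
  filter_upwards [coeFn_contClass g] with x hx
  rw [hx]
  exact norm_extendIcc_le g x

/-- Multiplication by a continuous function on `[-1, 1]`, as a function of the multiplier. -/
def contMul (g : C(Set.Icc (-1 : ℝ) 1, ℂ)) : ChebyshevLTwo →L[ℂ] ChebyshevLTwo :=
  mulOperator (extendIcc g) (memLp_extendIcc g ∞)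

theorem contMul_apply_ae (g : C(Set.Icc (-1 : ℝ) 1, ℂ)) (f : ChebyshevLTwo) :
    contMul g f =ᵐ[chebyshevMeasure] fun x => extendIcc g x * f x :=
  mulOperator_apply _ _ f

theorem contMul_contClass (g h : C(Set.Icc (-1 : ℝ) 1, ℂ)) :
    contMul g (contClass h) = contClass (g * h) := by
  refine Lp.ext ?_
  filter_upwards [contMul_apply_ae g (contClass h), coeFn_contClass h, coeFn_contClass (g * h)]
    with x h1 h2 h3
  rw [h1, h2, h3]
  rfl

theorem contMul_eq_mulOperator {g : C(Set.Icc (-1 : ℝ) 1, ℂ)} {f : ℝ → ℂ}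
    (hf : MemLp f ∞ chebyshevMeasure) (h : ∀ x : Set.Icc (-1 : ℝ) 1, g x = f x) :
    contMul g = mulOperator f hf := by
  ext1 u
  refine Lp.ext ?_
  filter_upwards [contMul_apply_ae g u, mulOperator_apply f hf u, ae_extendIcc_eq h]
    with x h1 h2 h3
  rw [h1, h2, h3]

/-- The representation of `C([-1, 1])` on the weighted space by multiplication operators. -/
def contMulHom : C(Set.Icc (-1 : ℝ) 1, ℂ) →⋆ₐ[ℂ] (ChebyshevLTwo →L[ℂ] ChebyshevLTwo) where
  toFun := contMul
  map_one' := by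
    ext1 u
    refine Lp.ext ?_
    filter_upwards [contMul_apply_ae 1 u] with x h1
    rw [h1]
    exact one_mul _
  map_mul' g h := by
    ext1 u
    refine Lp.ext ?_
    filter_upwards [contMul_apply_ae (g * h) u, contMul_apply_ae g (contMul h u),
      contMul_apply_ae h u] with x h1 h2 h3
    rw [mul_apply_eq_comp, h1, h2, h3]
    exact mul_assoc _ _ _
  map_zero' := by
    ext1 u
    refine Lp.ext ?_
    filter_upwards [contMul_apply_ae 0 u, Lp.coeFn_zero ℂ 2 chebyshevMeasure] with x h1 h2
    rw [h1, zero_apply, h2]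
    exact zero_mul _
  map_add' g h := by
    ext1 u
    refine Lp.ext ?_
    filter_upwards [contMul_apply_ae (g + h) u, contMul_apply_ae g u,
      contMul_apply_ae h u, Lp.coeFn_add (contMul g u) (contMul h u)] with x h1 h2 h3 h4
    rw [add_apply, h1, h4, Pi.add_apply, h2, h3]
    exact add_mul _ _ _
  commutes' c := by
    ext1 u
    refine Lp.ext ?_
    filter_upwards [contMul_apply_ae (algebraMap ℂ _ c) u, Lp.coeFn_smul c u] with x h1 h2
    rw [h1, Algebra.algebraMap_eq_smul_one, Algebra.algebraMap_eq_smul_one, smul_apply,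
      one_apply_eq_self, h2, Pi.smul_apply, smul_eq_mul]
    congr 1
    exact mul_one c
  map_star' g := by
    rw [ContinuousLinearMap.star_eq_adjoint, ContinuousLinearMap.eq_adjoint_iff]
    intro u v
    rw [L2.inner_def, L2.inner_def]
    refine integral_congr_ae ?_
    filter_upwards [contMul_apply_ae (star g) u, contMul_apply_ae g v] with x h1 h2
    have h3 : extendIcc (star g) x = conj (extendIcc g x) := rfl
    rw [h1, h2, h3]
    simp only [RCLike.inner_apply, map_mul, Complex.conj_conj]
    ring

theorem contMulHom_apply (g : C(Set.Icc (-1 : ℝ) 1, ℂ)) : contMulHom g = contMul g := rfl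

theorem contClass_denseRange : DenseRange contClass := by
  have h := BoundedContinuousFunction.toLp_denseRange ℂ chebyshevMeasure ℂ
    (p := 2) (by norm_num)
  refine h.mono ?_
  rintro _ ⟨f, rfl⟩
  refine ⟨⟨fun x => f x, by fun_prop⟩, Lp.ext ?_⟩
  filter_upwards [coeFn_contClass ⟨fun x => f x, by fun_prop⟩,
    BoundedContinuousFunction.coeFn_toLp chebyshevMeasure (p := 2) (𝕜 := ℂ) f,
    ae_extendIcc_eq (g := ⟨fun x => f x, by fun_prop⟩) (f := f) fun _ => rfl] with x h1 h2 h3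
  rw [h1, h3, h2]

/-! ### The orthonormal basis of Chebyshev polynomials -/

/-- A real polynomial as a continuous complex function on `[-1, 1]`. -/
def polyFun (p : ℝ[X]) : C(Set.Icc (-1 : ℝ) 1, ℂ) :=
  ⟨fun x => ((p.eval (x : ℝ) : ℝ) : ℂ), by fun_prop⟩

theorem polyFun_apply (p : ℝ[X]) (x : Set.Icc (-1 : ℝ) 1) :
    polyFun p x = ((p.eval (x : ℝ) : ℝ) : ℂ) := rfl

theorem polyFun_add (p q : ℝ[X]) : polyFun (p + q) = polyFun p + polyFun q := by
  ext x
  simp [polyFun_apply]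

theorem polyFun_C_mul (c : ℝ) (p : ℝ[X]) :
    polyFun (Polynomial.C c * p) = (c : ℂ) • polyFun p := by
  ext x
  simp [polyFun_apply]

/-- The vector `√(2/π) U_{n-1}`. -/
def chebyshevVec (n : ℤ) : ChebyshevLTwo :=
  ((Real.sqrt (2 / Real.pi) : ℝ) : ℂ) • contClass (polyFun (Polynomial.Chebyshev.U ℝ (n - 1)))

theorem coeFn_chebyshevVec (n : ℤ) : chebyshevVec n =ᵐ[chebyshevMeasure] fun x : ℝ =>
    ((Real.sqrt (2 / Real.pi) * (Polynomial.Chebyshev.U ℝ (n - 1)).eval x : ℝ) : ℂ) := by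
  have h := ae_extendIcc_eq (g := polyFun (Polynomial.Chebyshev.U ℝ (n - 1)))
    (f := fun x => ((Polynomial.Chebyshev.U ℝ (n - 1)).eval x : ℝ)) fun _ => rfl
  filter_upwards [Lp.coeFn_smul ((Real.sqrt (2 / Real.pi) : ℝ) : ℂ)
    (contClass (polyFun (Polynomial.Chebyshev.U ℝ (n - 1)))), coeFn_contClass _, h] with x h1 h2 h3
  rw [chebyshevVec, h1, Pi.smul_apply, h2, h3]
  simp

/-- Serves twice: `f = 1` for orthonormality, `f = 2^α (1-x)^α` for the matrix entries. -/
theorem inner_chebyshevVec {m n : ℤ} {u : ChebyshevLTwo} {f : ℝ → ℝ}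
    (hu : u =ᵐ[chebyshevMeasure] fun x => (f x : ℂ) * chebyshevVec n x) :
    inner ℂ (chebyshevVec m) u = ((2 / Real.pi * ∫ x, (Polynomial.Chebyshev.U ℝ (m - 1)).eval x *
      (Polynomial.Chebyshev.U ℝ (n - 1)).eval x * f x ∂chebyshevMeasure : ℝ) : ℂ) := by
  rw [L2.inner_def, ← integral_const_mul, ← integral_complex_ofReal]
  refine integral_congr_ae ?_
  filter_upwards [hu, coeFn_chebyshevVec m, coeFn_chebyshevVec n] with x h1 h2 h3
  have hs : Real.sqrt (2 / Real.pi) * Real.sqrt (2 / Real.pi) = 2 / Real.pi :=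
    Real.mul_self_sqrt (by positivity)
  rw [h1, h2, h3, RCLike.inner_apply, Complex.conj_ofReal, ← Complex.ofReal_mul,
    ← Complex.ofReal_mul]
  congr 1
  linear_combination ((Polynomial.Chebyshev.U ℝ (m - 1)).eval x *
    (Polynomial.Chebyshev.U ℝ (n - 1)).eval x * f x) * hs

theorem orthonormal_chebyshevVec : Orthonormal ℂ fun n : ℕ+ => chebyshevVec n := by
  rw [orthonormal_iff_ite]
  intro m n
  rw [inner_chebyshevVec (n := n) (f := fun _ => 1) (Filter.Eventually.of_forall fun x => by simp)]
  simp only [mul_one]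
  rw [integral_U_mul_U (by exact_mod_cast m.pos) (by exact_mod_cast n.pos)]
  have hpi := Real.pi_ne_zero
  by_cases h : m = n
  · subst h
    simp only [if_true]
    rw [show 2 / Real.pi * (Real.pi / 2) = 1 by field_simp]
    simp
  · rw [if_neg h, if_neg (by exact_mod_cast h)]
    simp

/-- The counterpart of `u₀ = 0`: the recurrence needs no special case at `n = 1`. -/
theorem chebyshevVec_zero : chebyshevVec 0 = 0 := by
  have h : polyFun 0 = 0 := ContinuousMap.ext fun x => by
    simp [polyFun_apply]
  rw [chebyshevVec, zero_sub, Polynomial.Chebyshev.U_neg_one, h, map_zero, smul_zero]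

theorem contMul_X_chebyshevVec (n : ℤ) :
    contMul (polyFun X) (chebyshevVec n) =
      (1 / 2 : ℂ) • (chebyshevVec (n - 1) + chebyshevVec (n + 1)) := by
  have hmul : polyFun X * polyFun (Polynomial.Chebyshev.U ℝ (n - 1)) =
      (1 / 2 : ℂ) • (polyFun (Polynomial.Chebyshev.U ℝ (n - 1 - 1)) +
        polyFun (Polynomial.Chebyshev.U ℝ (n + 1 - 1))) := by
    refine ContinuousMap.ext fun x => ?_
    have h := congrArg (Polynomial.eval (x : ℝ)) (Polynomial.Chebyshev.U_add_one ℝ (n - 1))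
    simp only [Polynomial.eval_sub, Polynomial.eval_mul, Polynomial.eval_X,
      Polynomial.eval_ofNat] at h
    rw [show n + 1 - 1 = n - 1 + 1 by ring]
    simp only [ContinuousMap.mul_apply, ContinuousMap.smul_apply, ContinuousMap.add_apply,
      polyFun_apply, h, Polynomial.eval_X, smul_eq_mul]
    push_cast
    ring
  rw [chebyshevVec, chebyshevVec, chebyshevVec, map_smul, contMul_contClass, hmul, map_smul,
    map_add]
  module

theorem contMul_X_pow_chebyshevVec_mem_span (k n : ℕ) :
    contMul (polyFun (X ^ k)) (chebyshevVec n) ∈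
      Submodule.span ℂ (Set.range fun n : ℕ+ => chebyshevVec n) := by
  induction k generalizing n with
  | zero =>
    have h : polyFun (X ^ 0) = 1 := by ext x; simp [polyFun_apply]
    rw [h, ← contMulHom_apply, map_one, one_apply_eq_self]
    rcases Nat.eq_zero_or_pos n with rfl | hn
    · rw [Nat.cast_zero, chebyshevVec_zero]
      exact zero_mem _
    · exact Submodule.subset_span ⟨⟨n, hn⟩, rfl⟩
  | succ k ih =>
    rcases Nat.eq_zero_or_pos n with rfl | hn
    · rw [Nat.cast_zero, chebyshevVec_zero, map_zero]
      exact zero_mem _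
    · obtain ⟨j, rfl⟩ := Nat.exists_eq_succ_of_ne_zero hn.ne'
      have h : polyFun (X ^ (k + 1)) = polyFun (X ^ k) * polyFun X := by
        ext x; simp [polyFun_apply, pow_succ]
      rw [h, ← contMulHom_apply, map_mul, mul_apply_eq_comp, contMulHom_apply,
        contMulHom_apply, contMul_X_chebyshevVec, map_smul, map_add]
      have h1 := ih j
      have h2 := ih (j + 2)
      have e1 : ((j.succ : ℕ) : ℤ) - 1 = j := by push_cast; ring
      have e2 : ((j.succ : ℕ) : ℤ) + 1 = (j + 2 : ℕ) := by push_cast; ring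
      rw [e1, e2]
      exact Submodule.smul_mem _ _ (add_mem h1 h2)

theorem contClass_polyFun_mem_span (p : ℝ[X]) :
    contClass (polyFun p) ∈ Submodule.span ℂ (Set.range fun n : ℕ+ => chebyshevVec n) := by
  induction p using Polynomial.induction_on' with
  | add p q hp hq =>
    rw [polyFun_add, map_add]
    exact add_mem hp hq
  | monomial k c =>
    have hs : ((Real.sqrt (2 / Real.pi) : ℝ) : ℂ) ≠ 0 := by
      exact_mod_cast (Real.sqrt_pos.2 (by positivity)).ne'
    -- Since `U_0 = 1`, the vector of index `1` is a nonzero constant, so this puts `X ^ k` itself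
    -- in the span.
    have h := contMul_X_pow_chebyshevVec_mem_span k 1
    rw [chebyshevVec, map_smul, contMul_contClass, Submodule.smul_mem_iff _ hs] at h
    have h1 : polyFun (X ^ k) * polyFun (Polynomial.Chebyshev.U ℝ (((1 : ℕ) : ℤ) - 1)) =
        polyFun (X ^ k) := by
      ext x; simp [polyFun_apply]
    rw [h1] at h
    rw [← Polynomial.C_mul_X_pow_eq_monomial, polyFun_C_mul, map_smul]
    exact Submodule.smul_mem _ _ h

theorem contClass_ofReal_mem_closure_span (f : C(Set.Icc (-1 : ℝ) 1, ℝ)) :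
    contClass ⟨fun x => (f x : ℂ), by fun_prop⟩ ∈
      (Submodule.span ℂ (Set.range fun n : ℕ+ => chebyshevVec n)).topologicalClosure := by
  let ι : C(Set.Icc (-1 : ℝ) 1, ℝ) → ChebyshevLTwo := fun f =>
    contClass ((⟨Complex.ofReal, Complex.continuous_ofReal⟩ : C(ℝ, ℂ)).comp f)
  have hι : Continuous ι := continuous_contClass.comp (ContinuousMap.continuous_postcomp _)
  have hclosed := (Submodule.isClosed_topologicalClosure
    (Submodule.span ℂ (Set.range fun n : ℕ+ => chebyshevVec n))).preimage hι
  have hf : f ∈ (polynomialFunctions (Set.Icc (-1 : ℝ) 1)).topologicalClosure := by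
    rw [polynomialFunctions_closure_eq_top]
    trivial
  refine closure_minimal ?_ hclosed hf
  rintro _ ⟨p, -, rfl⟩
  exact Submodule.le_topologicalClosure _ (contClass_polyFun_mem_span p)

theorem top_le_closure_span_chebyshevVec :
    ⊤ ≤ (Submodule.span ℂ (Set.range fun n : ℕ+ => chebyshevVec n)).topologicalClosure := by
  intro u _
  refine closure_minimal ?_ (Submodule.isClosed_topologicalClosure _) (contClass_denseRange u)
  rintro _ ⟨g, rfl⟩
  have hg : g = (⟨fun x => ((g x).re : ℂ), by fun_prop⟩ : C(Set.Icc (-1 : ℝ) 1, ℂ)) +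
      Complex.I • ⟨fun x => ((g x).im : ℂ), by fun_prop⟩ := by
    ext x
    simp [mul_comm Complex.I]
  rw [hg, map_add, map_smul]
  exact add_mem (contClass_ofReal_mem_closure_span ⟨fun x => (g x).re, by fun_prop⟩)
    (Submodule.smul_mem _ _
      (contClass_ofReal_mem_closure_span ⟨fun x => (g x).im, by fun_prop⟩))

/-- The Chebyshev transform. -/
def chebyshevTransform : EllTwo ≃ₗᵢ[ℂ] ChebyshevLTwo :=
  (HilbertBasis.mk orthonormal_chebyshevVec top_le_closure_span_chebyshevVec).repr.symm

theorem chebyshevTransform_stdVec (n : ℕ+) :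
    chebyshevTransform (stdVec n) = chebyshevVec n := by
  rw [chebyshevTransform, stdVec, HilbertBasis.repr_symm_single, HilbertBasis.coe_mk]

theorem isChebyshevTransform_chebyshevTransform : IsChebyshevTransform chebyshevTransform := by
  intro n
  rw [chebyshevTransform_stdVec]
  exact coeFn_chebyshevVec n

/-! ### Diagonalization of the Laplacian -/

theorem stdVec_apply (n i : ℕ+) : stdVec n i = if (i : ℕ) = n then 1 else 0 := by
  change Pi.single (M := fun _ : ℕ+ => ℂ) n (1 : ℂ) i = _
  rw [Pi.single_apply]
  simp only [← PNat.coe_inj]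

theorem extZero_stdVec_sub_one (n i : ℕ+) :
    extZero (stdVec n) ((i : ℕ) - 1) = if (i : ℕ) = n + 1 then 1 else 0 := by
  have hn := n.pos
  rw [extZero]
  split_ifs with h1 h2 h2
  · exact (stdVec_apply n _).trans (if_pos (by simp [h2]))
  · exact (stdVec_apply n _).trans (if_neg (by simp only [PNat.mk_coe]; omega))
  · omega
  · rfl

theorem chebyshevTransform_symm_chebyshevVec (k : ℕ) (i : ℕ+) :
    chebyshevTransform.symm (chebyshevVec k) i = if (i : ℕ) = k then 1 else 0 := by
  rcases Nat.eq_zero_or_pos k with rfl | hk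
  · rw [Nat.cast_zero, chebyshevVec_zero, map_zero, if_neg i.pos.ne']
    rfl
  · have h := chebyshevTransform_stdVec ⟨k, hk⟩
    rw [PNat.mk_coe] at h
    rw [← h, LinearIsometryEquiv.symm_apply_apply]
    exact stdVec_apply _ i

theorem negLaplacian_stdVec (n : ℕ+) :
    negLaplacian (stdVec n) = chebyshevTransform.symm
      (-chebyshevVec (n - 1) + (2 : ℂ) • chebyshevVec n - chebyshevVec (n + 1)) := by
  have e1 : ((n : ℕ) : ℤ) - 1 = ((n - 1 : ℕ) : ℤ) := by
    have := n.pos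
    omega
  have e2 : ((n : ℕ) : ℤ) + 1 = ((n + 1 : ℕ) : ℤ) := by push_cast; rfl
  rw [e1, e2, map_sub, map_add, map_neg, map_smul]
  ext i
  rw [negLaplacian_apply, lp.coeFn_sub, Pi.sub_apply, lp.coeFn_add, Pi.add_apply, lp.coeFn_neg,
    Pi.neg_apply, lp.coeFn_smul, Pi.smul_apply]
  rw [extZero_stdVec_sub_one, stdVec_apply, stdVec_apply, PNat.add_coe, PNat.val_ofNat,
    chebyshevTransform_symm_chebyshevVec, chebyshevTransform_symm_chebyshevVec,
    chebyshevTransform_symm_chebyshevVec, smul_eq_mul]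
  have hn := n.pos
  -- The subtraction is truncated; `i ≥ 1` and `n ≥ 1` make the two conditions agree, both failing
  -- for `n = 1`.
  have h : ((i : ℕ) = n - 1) = ((i : ℕ) + 1 = n) := by
    have := i.pos
    exact propext (by omega)
  simp only [h]
  ring

/-- The symbol `2 (1 - x)` of the Laplacian. -/
def laplacianSymbol : C(Set.Icc (-1 : ℝ) 1, ℂ) :=
  ⟨fun x => ((2 * (1 - (x : ℝ)) : ℝ) : ℂ), by fun_prop⟩

theorem contMul_laplacianSymbol_chebyshevVec (n : ℤ) :
    contMul laplacianSymbol (chebyshevVec n) =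
      -chebyshevVec (n - 1) + (2 : ℂ) • chebyshevVec n - chebyshevVec (n + 1) := by
  have h : laplacianSymbol = (2 : ℂ) • (1 - polyFun X) := by
    ext x
    simp [laplacianSymbol, polyFun_apply]
  rw [h, ← contMulHom_apply, map_smul, map_sub, map_one, contMulHom_apply,
    smul_apply, sub_apply, contMul_X_chebyshevVec,
    one_apply_eq_self]
  module

/-- The representation of `C([-1, 1])` on `ℓ²(ℕ)` obtained from multiplication operators. -/
def ellTwoRep : C(Set.Icc (-1 : ℝ) 1, ℂ) →⋆ₐ[ℂ] (EllTwo →L[ℂ] EllTwo) :=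
  (chebyshevTransform.symm.conjStarAlgEquiv : _ →⋆ₐ[ℂ] _).comp contMulHom

theorem ellTwoRep_apply (g : C(Set.Icc (-1 : ℝ) 1, ℂ)) (u : EllTwo) :
    ellTwoRep g u = chebyshevTransform.symm (contMul g (chebyshevTransform u)) := rfl

theorem ellTwoRep_laplacianSymbol : ellTwoRep laplacianSymbol = negLaplacian := by
  refine lp.ext_continuousLinearMap (by norm_num) fun n => ContinuousLinearMap.ext_ring ?_
  change ellTwoRep laplacianSymbol (stdVec n) = negLaplacian (stdVec n)
  rw [ellTwoRep_apply, chebyshevTransform_stdVec, contMul_laplacianSymbol_chebyshevVec,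
    negLaplacian_stdVec]

/-- The symbol is `star b * b` with `b = √(2(1-x))`, and a star homomorphism preserves this form. -/
theorem negLaplacian_nonneg : 0 ≤ negLaplacian := by
  let b : C(Set.Icc (-1 : ℝ) 1, ℂ) := ⟨fun x => ((√(2 * (1 - (x : ℝ))) : ℝ) : ℂ), by fun_prop⟩
  have hb : laplacianSymbol = star b * b := by
    ext x
    have h0 : 0 ≤ 2 * (1 - (x : ℝ)) := by linarith [x.2.2]
    change ((2 * (1 - (x : ℝ)) : ℝ) : ℂ) = conj ((√(2 * (1 - (x : ℝ))) : ℝ) : ℂ) *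
      ((√(2 * (1 - (x : ℝ))) : ℝ) : ℂ)
    rw [Complex.conj_ofReal, ← Complex.ofReal_mul, Real.mul_self_sqrt h0]
  rw [← ellTwoRep_laplacianSymbol, hb, map_mul, map_star]
  exact star_mul_self_nonneg _

/-- Evaluation at `x` is a star homomorphism to `ℂ`, so it commutes with the calculus. -/
theorem cfc_laplacianSymbol {f : ℂ → ℂ} (hf : Continuous f) (x : Set.Icc (-1 : ℝ) 1) :
    cfc f laplacianSymbol x = f ((2 * (1 - (x : ℝ)) : ℝ) : ℂ) := by
  have h := (ContinuousMap.evalStarAlgHom ℂ ℂ x).map_cfc f laplacianSymbol hf.continuousOn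
    (continuous_eval_const x)
  have h2 : (ContinuousMap.evalStarAlgHom ℂ ℂ x) laplacianSymbol =
    algebraMap ℂ ℂ ((2 * (1 - (x : ℝ)) : ℝ) : ℂ) := rfl
  rw [h2, cfc_algebraMap] at h
  exact h

/-- Passes to the complex calculus, in which the power is transported along `ellTwoRep`. -/
theorem operatorPow_eq_cfc {H : Type*} [NormedAddCommGroup H] [InnerProductSpace ℂ H]
    [CompleteSpace H] {T : H →L[ℂ] H} (hT : 0 ≤ T) (α : ℝ) :
    operatorPow T α = cfc (fun z : ℂ => ((z.re ^ α : ℝ) : ℂ)) T := by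
  have h : operatorPow T α = cfc (fun t : ℝ => t ^ α) T := CFC.rpow_eq_cfc_real hT
  rw [h, cfc_real_eq_complex]

theorem negLaplacianPow_eq_ellTwoRep {α : ℝ} (hα : 0 < α) :
    negLaplacianPow α = ellTwoRep (cfc (fun z : ℂ => ((z.re ^ α : ℝ) : ℂ)) laplacianSymbol) := by
  have hc : Continuous fun z : ℂ => ((z.re ^ α : ℝ) : ℂ) :=
    Complex.continuous_ofReal.comp (Complex.continuous_re.rpow_const fun _ => Or.inr hα.le)
  have hr : Continuous ellTwoRep :=
    AddMonoidHomClass.continuous_of_bound ellTwoRep 1 fun g => by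
      rw [one_mul]
      exact NonUnitalStarAlgHom.norm_apply_le ellTwoRep g
  have hn : IsStarNormal (ellTwoRep laplacianSymbol) := by
    rw [ellTwoRep_laplacianSymbol]
    exact (IsSelfAdjoint.of_nonneg negLaplacian_nonneg).isStarNormal
  rw [ellTwoRep.map_cfc _ laplacianSymbol hc.continuousOn hr
    ⟨mul_comm _ _⟩ hn, ellTwoRep_laplacianSymbol]
  exact operatorPow_eq_cfc negLaplacian_nonneg α

theorem negLaplacianPow_apply {α : ℝ} (hα : 0 < α) (u : EllTwo) :
    negLaplacianPow α u = chebyshevTransform.symm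
      (mulOperator (powSymbol α) (memLp_powSymbol hα) (chebyshevTransform u)) := by
  have hc : Continuous fun z : ℂ => ((z.re ^ α : ℝ) : ℂ) :=
    Complex.continuous_ofReal.comp (Complex.continuous_re.rpow_const fun _ => Or.inr hα.le)
  rw [negLaplacianPow_eq_ellTwoRep hα, ellTwoRep_apply,
    contMul_eq_mulOperator (memLp_powSymbol hα) fun x => ?_]
  rw [cfc_laplacianSymbol hc, Complex.ofReal_re, powSymbol,
    Real.mul_rpow (by norm_num) (by linarith [x.2.2])]

theorem matrixEntry_negLaplacianPow {α : ℝ} (hα : 0 < α) (m n : ℕ+) :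
    matrixEntry (negLaplacianPow α) m n =
      (((-1 : ℝ) ^ ((m : ℕ) + (n : ℕ)) *
        (genBinom (2 * α) (α + (m : ℝ) - (n : ℝ)) -
          genBinom (2 * α) (α + (m : ℝ) + (n : ℝ))) : ℝ) : ℂ) := by
  have hg : (fun θ : ℝ => (2 : ℝ) ^ α * (1 - Real.cos θ) ^ α) =
      fun θ : ℝ => (2 - 2 * Real.cos θ) ^ α := by
    funext θ
    rw [← Real.mul_rpow (by norm_num) (by linarith [Real.cos_le_one θ])]
    ring_nf
  have hu := mulOperator_apply (powSymbol α) (memLp_powSymbol hα) (chebyshevVec n)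
  have hcos := integral_U_mul_U_mul (g := fun x => (2 : ℝ) ^ α * (1 - x) ^ α)
    (by rw [hg]; exact continuous_two_sub_two_cos_rpow hα) m n
  have hg' := fun θ => congrFun hg θ
  simp only [hg'] at hcos
  have hm := cosCoeff_sub hα m n
  have hp := cosCoeff_natCast hα (m + n)
  rw [cosCoeff] at hm hp
  push_cast at hm hp hcos
  rw [hm, hp] at hcos
  -- Unitarity moves the inner product to the weighted space; the normalization `2/π` meets the
  -- `1/2` of the product formula and the `π` in each coefficient.
  rw [matrixEntry, negLaplacianPow_apply hα, ← chebyshevTransform.inner_map_map,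
    LinearIsometryEquiv.apply_symm_apply, chebyshevTransform_stdVec, chebyshevTransform_stdVec,
    inner_chebyshevVec hu, hcos]
  congr 1
  have hpi := Real.pi_ne_zero
  rw [← add_assoc]
  field_simp

end DiscreteLaplacian

end

theorem mainTheorem6 :
    ∃ 𝒰 : DiscreteLaplacian.EllTwo ≃ₗᵢ[ℂ] DiscreteLaplacian.ChebyshevLTwo,
      DiscreteLaplacian.IsChebyshevTransform 𝒰 ∧
      ∀ (α : ℝ) (hα : 0 < α),
        DiscreteLaplacian.negLaplacianPow α =
          (𝒰.symm.toContinuousLinearEquiv : DiscreteLaplacian.ChebyshevLTwo →L[ℂ]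
              DiscreteLaplacian.EllTwo) ∘L
            DiscreteLaplacian.mulOperator (DiscreteLaplacian.powSymbol α)
              (DiscreteLaplacian.memLp_powSymbol hα) ∘L
            (𝒰.toContinuousLinearEquiv : DiscreteLaplacian.EllTwo →L[ℂ]
              DiscreteLaplacian.ChebyshevLTwo) ∧
        ∀ m n : ℕ+,
          DiscreteLaplacian.matrixEntry (DiscreteLaplacian.negLaplacianPow α) m n =
            (((-1 : ℝ) ^ ((m : ℕ) + (n : ℕ)) *
              (DiscreteLaplacian.genBinom (2 * α) (α + (m : ℝ) - (n : ℝ)) -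
                DiscreteLaplacian.genBinom (2 * α) (α + (m : ℝ) + (n : ℝ))) : ℝ) : ℂ) := by
  refine ⟨DiscreteLaplacian.chebyshevTransform,
    DiscreteLaplacian.isChebyshevTransform_chebyshevTransform, fun α hα => ⟨?_, fun m n =>
      DiscreteLaplacian.matrixEntry_negLaplacianPow hα m n⟩⟩
  ext1 u
  exact DiscreteLaplacian.negLaplacianPow_apply hα u
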